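/- **Theorem 1.** Consider a wireless network with nodes $1,\dots,k$, where node $1$ is the source. In channel use $t$ node $i$ sends $x_{i,t}\in\mathbb{C}$ and node $j$ receives $$y_{j,t}=\sum_{i=1}^k h_{ij,t}\,x_{i,t}+z_{j,t}.$$ The noise terms $z_{j,t}\sim\mathcal{CN}(0,N_0)$, $N_0>0$, are independent over nodes and times. The fading matrices $H_t=(h_{ij,t})_{i,j}$ are independent and identically distributed over $t$ and independent of the noise; $h_{ii,t}=0$, every $h_{ij,t}$ is circularly symmetric (its law is invariant under rotations of $\mathbb C$), and $h_{ij,t}$, $h_{lm,t}$ are independent whenever $(i,j)\neq(l,m)$. Write $\mathbb{E}|h_{ij}|^2\in[0,\infty]$ for the channel gains. A code of block length $n$ with $M$ messages consists of codewords $x_1^{(n)}(m)\in\mathbb{C}^n$, $m\in\{1,\dots,M\}$, sent by the source; causal (measurable) relay functions $x_{i,t}=x_{i,t}(y_{i,1},\dots,y_{i,t-1})$ at the nodes $i\ne1$; and (measurable) decoding functions $\hat m_j=\hat m_j(y_{j,1},\dots,y_{j,n})$. For a non-empty destination set $\mathcal R\subseteq\{2,\dots,k\}$ and equiprobable messages $m$,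 its error probability is $P[\exists j\in\mathcal R:\hat m_j\neq m]$, and its energy is $\mathbb{E}\sum_{i=1}^k\sum_{t=1}^n|x_{i,t}|^2$. An $(n,M,E,\epsilon)$ code is one with energy at most $E$ and error probability at most $\epsilon$. A number $E_b\ge0$ is an achievable energy per bit if for every $0<\epsilon<1$ and every $\delta>0$ there is an $E_0\ge 0$ such that for every $E\ge E_0$ there is an $(n,M,E,\epsilon)$ code, for some $n$ and some $M\ge2$, with $E/\log_2M<E_b+\delta$. Let ${E_b}_{\min}(\mathcal R)$ be the infimum of all achievable energies per bit ($\infty$ if there are none), and $\frac{E_b}{N_0}_{\min}(\mathcal R)={E_b}_{\min}(\mathcal R)/N_0$. Then $$\frac{E_b}{N_0}_{\min}(\mathcal R)\;\ge\;\frac{\ln 2}{G(\mathcal R)},\qquad G(\mathcal R)=\frac1{|\mathcal R|}\max_{1\le i\le k}\ \sum_{j\in\mathcal R\setminus\{i\}}\mathbb{E}|h_{ij}|^2,$$ where $G(\mathcal R)$ is the effective network radius, and the right-hand side is $\infty$ if $G(\mathcal R)=0$ and $0$ if $G(\mathcal R)=\infty$. The same bound holds if channel state information is available except at the transmitters for the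 current channel use, that is, if the relay functions $x_{i,t}$ may depend also on the past fading matrices $H_1,\dots,H_{t-1}$ and the decoding functions also on $H_1,\dots,H_n$. -/

import Mathlib

open MeasureTheory ProbabilityTheory
open scoped NNReal ENNReal

/-- The circularly symmetric complex Gaussian law `CN(0, v)`: the real and imaginary parts are
independent real Gaussians of mean `0` and variance `v / 2`. -/
noncomputable def complexNormal (v : ℝ≥0) : Measure ℂ :=
  ((gaussianReal 0 (v / 2)).prod (gaussianReal 0 (v / 2))).map Complex.measurableEquivRealProd.symm

instance (v : ℝ≥0) : IsProbabilityMeasure (complexNormal v) :=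
  Measure.isProbabilityMeasure_map Complex.measurableEquivRealProd.symm.measurable.aemeasurable

/-- Fading state of the network in one channel use: `H i j` is the fading coefficient of the link
from node `i` to node `j`. -/
abbrev FadingState (k : ℕ) : Type := Fin k → Fin k → ℂ

/-- A wireless network with `k` nodes: a source node, the noise spectral density, and the joint law
of the fading coefficients in a single channel use. -/
structure WirelessNetwork (k : ℕ) where
  /-- the source node -/
  src : Fin k
  /-- the noise spectral density `N₀` -/
  N₀ : ℝ≥0
  N₀_pos : 0 < N₀
  /-- the law of the fading state in one channel use -/
  fadingLaw : Measure (FadingState k)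
  isProb : IsProbabilityMeasure fadingLaw
  /-- no fading coefficient from a node to itself -/
  diag_zero : ∀ᵐ H ∂fadingLaw, ∀ i, H i i = 0
  /-- every fading coefficient is circularly symmetric -/
  circular : ∀ i j, ∀ c : ℂ, ‖c‖ = 1 →
    fadingLaw.map (fun H => c * H i j) = fadingLaw.map (fun H => H i j)
  /-- fading coefficients of different links are (pairwise) independent -/
  indep : ∀ i j l m, (i, j) ≠ (l, m) →
    IndepFun (fun H : FadingState k => H i j) (fun H : FadingState k => H l m) fadingLaw

attribute [instance] WirelessNetwork.isProb

namespace WirelessNetwork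

variable {k : ℕ} (net : WirelessNetwork k)

/-- The channel gain `E[|h_ij|²]` of the link from `i` to `j`. -/
noncomputable def gain (i j : Fin k) : ℝ≥0∞ :=
  ∫⁻ H, ‖H i j‖ₑ ^ 2 ∂net.fadingLaw

/-- The effective network radius
`G(R) = (1 / |R|) * max_i ∑_{j ∈ R \ {i}} E[|h_ij|²]`. -/
noncomputable def effectiveRadius (R : Finset (Fin k)) : ℝ≥0∞ :=
  (⨆ i : Fin k, ∑ j ∈ R.erase i, net.gain i j) / (R.card : ℝ≥0∞)

/-- The law of the fading states and noise terms over `n` channel uses: i.i.d. in time; within one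
channel use, the noise is independent of the fading, and the noise terms at the `k` nodes are
independent `CN(0, N₀)` variables. -/
noncomputable def channelLaw (n : ℕ) : Measure (Fin n → FadingState k × (Fin k → ℂ)) :=
  Measure.pi fun _ : Fin n =>
    net.fadingLaw.prod (Measure.pi fun _ : Fin k => complexNormal net.N₀)

end WirelessNetwork

/-- A (causal) code for a network with `k` nodes, of block length `n` and with `M` messages. The
source sends a codeword determined by the message. Any other node sends at time `t` a function of
what it observed at the earlier times, an observation at one time being an element of `α`. The
decoders estimate the message from all `n` observations of their node. (The relay function of the
source and the decoders outside the destination set are not used.) -/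
structure NetworkCode (k : ℕ) (α : Type) [MeasurableSpace α] (n M : ℕ) where
  /-- the source codewords -/
  codeword : Fin M → Fin n → ℂ
  /-- the relay functions -/
  relay : Fin k → (t : Fin n) → (Fin (t : ℕ) → α) → ℂ
  relay_measurable : ∀ i t, Measurable (relay i t)
  /-- the decoding functions -/
  decode : Fin k → (Fin n → α) → Fin M
  decode_measurable : ∀ i, Measurable (decode i)

namespace NetworkCode

variable {k : ℕ} {α : Type} [MeasurableSpace α] {n M : ℕ}
  (c : NetworkCode k α n M) (net : WirelessNetwork k) (obs : FadingState k → ℂ → α)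

/-- What node `j` observes at time `t` when `m` is the message and `ω` lists the fading states and
the noise vectors: `obs H y`, where `y = ∑ i, h_ij x_i + z_j` is the channel output at `j`. -/
noncomputable def observed (m : Fin M) (ω : Fin n → FadingState k × (Fin k → ℂ))
    (t : Fin n) (j : Fin k) : α :=
  obs (ω t).1
    (∑ i : Fin k, (ω t).1 i j *
        (if i = net.src then c.codeword m t
          else c.relay i t fun s : Fin (t : ℕ) => observed m ω ⟨s, s.2.trans t.2⟩ i)
      + (ω t).2 j)
termination_by (t : ℕ)
decreasing_by exact s.2

/-- The symbol `x_{i,t}` that node `i` sends at time `t`. -/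
noncomputable def sent (m : Fin M) (ω : Fin n → FadingState k × (Fin k → ℂ))
    (t : Fin n) (i : Fin k) : ℂ :=
  if i = net.src then c.codeword m t
  else c.relay i t fun s : Fin (t : ℕ) => c.observed net obs m ω ⟨s, s.2.trans t.2⟩ i

/-- The expected total energy of the code, for equiprobable messages. -/
noncomputable def energy : ℝ≥0∞ :=
  (∑ m : Fin M, ∫⁻ ω, ∑ i : Fin k, ∑ t : Fin n, ‖c.sent net obs m ω t i‖ₑ ^ 2
    ∂net.channelLaw n) / (M : ℝ≥0∞)

/-- The probability that some node of the destination set `R` decodes incorrectly, for equiprobable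
messages. -/
noncomputable def errorProb (R : Finset (Fin k)) : ℝ≥0∞ :=
  (∑ m : Fin M, net.channelLaw n
    {ω | ∃ j ∈ R, c.decode j (fun t => c.observed net obs m ω t j) ≠ m}) / (M : ℝ≥0∞)

end NetworkCode

namespace WirelessNetwork

variable {k : ℕ} {α : Type} [MeasurableSpace α]
  (net : WirelessNetwork k) (obs : FadingState k → ℂ → α) (R : Finset (Fin k))

/-- There is an `(n, M, E, ε)` code: expected total energy at most `E`, error probability at most
`ε`. -/
def HasCode (n M : ℕ) (E ε : ℝ) : Prop :=
  ∃ c : NetworkCode k α n M,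
    c.energy net obs ≤ ENNReal.ofReal E ∧ c.errorProb net obs R ≤ ENNReal.ofReal ε

/-- `Eb` is an `ε`-achievable energy per bit. (The energy per bit of a code with one message is
infinite, so `M` is at least two.) -/
def IsEpsAchievable (ε : ℝ) (Eb : ℝ≥0) : Prop :=
  ∀ δ : ℝ, 0 < δ → ∃ E₀ : ℝ, 0 ≤ E₀ ∧ ∀ E : ℝ, E₀ ≤ E →
    ∃ n M : ℕ, 2 ≤ M ∧ net.HasCode obs R n M E ε ∧ E / Real.logb 2 M < Eb + δ

/-- `Eb` is an achievable energy per bit. -/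
def IsAchievable (Eb : ℝ≥0) : Prop :=
  ∀ ε : ℝ, 0 < ε → ε < 1 → net.IsEpsAchievable obs R ε Eb

/-- The minimum energy per bit, `∞` if no energy per bit is achievable. -/
noncomputable def minEnergyPerBit : ℝ≥0∞ :=
  ⨅ (Eb : ℝ≥0) (_ : net.IsAchievable obs R Eb), (Eb : ℝ≥0∞)

/-- The minimum energy per bit normalized by the noise spectral density. -/
noncomputable def normalizedMinEnergyPerBit : ℝ≥0∞ :=
  net.minEnergyPerBit obs R / (net.N₀ : ℝ≥0∞)

end WirelessNetwork

/-- Nodes observe their channel outputs only. -/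
def outputOnly (k : ℕ) : FadingState k → ℂ → ℂ := fun _ y => y

/-- Nodes observe their channel outputs and, on the receiving side, the fading state of the whole
network. By causality a transmitted symbol still depends on earlier fading states only, hence is
independent of the current one. -/
def outputAndFading (k : ℕ) : FadingState k → ℂ → ℂ × FadingState k := fun H y => (y, H)

/-! Reliable decoding at a destination forces its actual output to be far from pure noise, and that
distance is paid for in received energy. Fix a destination `j` and a message `m`, and let `L` be the
log-likelihood ratio of the output at `j` to pure noise. Inputs are causal, so replacing the noise
at `j` by the output, one channel use at a time, and weighting by `exp (-L)` reproduces the channel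
law (`lintegral_receivedPath_mul_exp`), despite feedback through the relays.

Testing this identity with `log M` on the event of correct decoding bounds `log M` times its
probability by `E[L]` plus `M` times the probability that pure noise decodes to `m`
(`log_mul_prob_correct_le`). The signal is uncorrelated with the current noise, so `E[L]` is the
energy received at `j` divided by `N₀`. The pure-noise events partition the space over `m`, so the
second term averages to `1` over messages.

Links into `j` are centered and pairwise independent, and the inputs do not see the current fading,
so cross terms vanish: received powers add without coherent gain. Summing over `R`, each unit of
transmitted energy yields at most `|R| * G(R)` of received energy (`sum_received_energy_le`). Hence
`(1 - ε) log M ≤ G(R) E / N₀ + 1` (`log_card_le`); large `E` makes the constant negligible. Only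
measurability of the observation map is used, so both observation models follow together. -/

/-- Two functions on a finite product space have the same integral if they have the same integral
along every line parallel to a fixed coordinate axis. -/
theorem lintegral_pi_eq_of_update {ι : Type*} [Fintype ι] [DecidableEq ι] {X : ι → Type*}
    [∀ i, MeasurableSpace (X i)] (μ : ∀ i, Measure (X i)) [∀ i, SigmaFinite (μ i)] (i : ι)
    {f g : (∀ i, X i) → ℝ≥0∞} (hf : Measurable f) (hg : Measurable g)
    (h : ∀ ω, ∫⁻ x, f (Function.update ω i x) ∂μ i = ∫⁻ x, g (Function.update ω i x) ∂μ i) :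
    ∫⁻ ω, f ω ∂Measure.pi μ = ∫⁻ ω, g ω ∂Measure.pi μ := by
  refine lintegral_eq_of_lmarginal_eq {i} hf hg ?_
  rw [lmarginal_singleton, lmarginal_singleton]
  exact funext h

/-! ### Causal change of measure on product spaces -/

section Causal

variable {n : ℕ} {X : Type*}

/-- The path `ω` with its coordinates before time `r` transformed by `τ`. -/
def transformBefore (τ : Fin n → (Fin n → X) → X) (r : ℕ) (ω : Fin n → X) : Fin n → X :=
  fun t => if (t : ℕ) < r then τ t ω else ω t

theorem transformBefore_zero (τ : Fin n → (Fin n → X) → X) (ω : Fin n → X) :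
    transformBefore τ 0 ω = ω := by
  funext t
  simp [transformBefore]

theorem transformBefore_self (τ : Fin n → (Fin n → X) → X) (ω : Fin n → X) :
    transformBefore τ n ω = fun t => τ t ω := by
  funext t
  simp [transformBefore]

/-- The product of the weights before time `r`. -/
noncomputable def weightBefore (w : Fin n → (Fin n → X) → ℝ≥0∞) (r : ℕ) (ω : Fin n → X) : ℝ≥0∞ :=
  ∏ t : Fin n, if (t : ℕ) < r then w t ω else 1

variable [MeasurableSpace X]

theorem measurable_transformBefore {τ : Fin n → (Fin n → X) → X} (hτ : ∀ t, Measurable (τ t))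
    (r : ℕ) : Measurable (transformBefore τ r) := by
  refine measurable_pi_lambda _ fun t => ?_
  unfold transformBefore
  split_ifs
  · exact hτ t
  · exact measurable_pi_apply t

theorem measurable_weightBefore {w : Fin n → (Fin n → X) → ℝ≥0∞} (hw : ∀ t, Measurable (w t))
    (r : ℕ) : Measurable (weightBefore w r) := by
  refine Finset.measurable_fun_prod _ fun t _ => ?_
  split_ifs
  · exact hw t
  · exact measurable_const

/-- Freeze every coordinate except `r`. By causality the transformed past and the earlier weights
are constant along this line, and later coordinates are still untransformed, so only the
one-coordinate identity `h` is needed. -/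
theorem lintegral_transformBefore_succ (μ : Measure X) [IsProbabilityMeasure μ]
    {τ : Fin n → (Fin n → X) → X} {w : Fin n → (Fin n → X) → ℝ≥0∞}
    (hτ : ∀ t, Measurable (τ t)) (hw : ∀ t, Measurable (w t))
    (hτ_causal : ∀ t s, t < s → ∀ ω x, τ t (Function.update ω s x) = τ t ω)
    (hw_causal : ∀ t s, t < s → ∀ ω x, w t (Function.update ω s x) = w t ω)
    (h : ∀ t ω (g : X → ℝ≥0∞), Measurable g →
      ∫⁻ x, g (τ t (Function.update ω t x)) * w t (Function.update ω t x) ∂μ = ∫⁻ x, g x ∂μ)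
    {g : (Fin n → X) → ℝ≥0∞} (hg : Measurable g) {r : ℕ} (hr : r < n) :
    ∫⁻ ω, g (transformBefore τ (r + 1) ω) * weightBefore w (r + 1) ω ∂Measure.pi (fun _ => μ) =
      ∫⁻ ω, g (transformBefore τ r ω) * weightBefore w r ω ∂Measure.pi (fun _ => μ) := by
  refine lintegral_pi_eq_of_update (fun _ => μ) ⟨r, hr⟩
    ((hg.comp (measurable_transformBefore hτ _)).mul (measurable_weightBefore hw _))
    ((hg.comp (measurable_transformBefore hτ _)).mul (measurable_weightBefore hw _)) fun ω => ?_
  set i : Fin n := ⟨r, hr⟩ with hi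
  set b := transformBefore τ r ω with hb
  have h1 : ∀ x, transformBefore τ r (Function.update ω i x) = Function.update b i x := by
    intro x
    funext t
    rcases lt_trichotomy t i with hlt | rfl | hlt
    · have : (t : ℕ) < r := hlt
      simp [transformBefore, hb, this, hlt.ne, hτ_causal t i hlt]
    · simp [transformBefore, hi]
    · have : ¬ (t : ℕ) < r := not_lt.2 (le_of_lt hlt)
      simp [transformBefore, hb, this, hlt.ne']
  have h2 : ∀ x, transformBefore τ (r + 1) (Function.update ω i x) =
      Function.update b i (τ i (Function.update ω i x)) := by
    intro x
    funext t
    rcases lt_trichotomy t i with hlt | rfl | hlt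
    · have : (t : ℕ) < r := hlt
      have h' : (t : ℕ) < r + 1 := by omega
      simp [transformBefore, hb, this, h', hlt.ne, hτ_causal t i hlt]
    · simp [transformBefore, hi]
    · have : ¬ (t : ℕ) < r := not_lt.2 (le_of_lt hlt)
      have h' : ¬ (t : ℕ) < r + 1 := not_lt.2 hlt
      simp [transformBefore, hb, this, h', hlt.ne']
  have h3 : ∀ x, weightBefore w r (Function.update ω i x) = weightBefore w r ω := by
    intro x
    refine Finset.prod_congr rfl fun t _ => ?_
    split_ifs with htr
    · exact hw_causal t i htr ω x
    · rfl
  have h4 : ∀ ω, weightBefore w (r + 1) ω = weightBefore w r ω * w i ω := by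
    intro ω
    have : w i ω = ∏ t, if t = i then w t ω else 1 := by simp
    rw [this, weightBefore, weightBefore, ← Finset.prod_mul_distrib]
    refine Finset.prod_congr rfl fun t _ => ?_
    rcases lt_trichotomy t i with hlt | rfl | hlt
    · have : (t : ℕ) < r := hlt
      have h' : (t : ℕ) < r + 1 := by omega
      simp [this, h', hlt.ne]
    · simp [hi]
    · have : ¬ (t : ℕ) < r := not_lt.2 (le_of_lt hlt)
      have h' : ¬ (t : ℕ) < r + 1 := not_lt.2 hlt
      simp [this, h', hlt.ne']
  have hgb : Measurable fun x => g (Function.update b i x) := hg.comp (measurable_update b)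
  simp only [h1, h2, h3, h4]
  rw [lintegral_mul_const _ hgb, ← h i ω _ hgb, ← lintegral_mul_const _]
  · exact lintegral_congr fun x => by ring
  · exact (hgb.comp ((hτ i).comp (measurable_update ω))).mul ((hw i).comp (measurable_update ω))

/-- Causal change of measure on a product space: if at each time the weighted transformation
preserves the measure of that time, whatever the past, then so does the whole transformation. -/
theorem lintegral_causal_transform (μ : Measure X) [IsProbabilityMeasure μ]
    {τ : Fin n → (Fin n → X) → X} {w : Fin n → (Fin n → X) → ℝ≥0∞}
    (hτ : ∀ t, Measurable (τ t)) (hw : ∀ t, Measurable (w t))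
    (hτ_causal : ∀ t s, t < s → ∀ ω x, τ t (Function.update ω s x) = τ t ω)
    (hw_causal : ∀ t s, t < s → ∀ ω x, w t (Function.update ω s x) = w t ω)
    (h : ∀ t ω (g : X → ℝ≥0∞), Measurable g →
      ∫⁻ x, g (τ t (Function.update ω t x)) * w t (Function.update ω t x) ∂μ = ∫⁻ x, g x ∂μ)
    {g : (Fin n → X) → ℝ≥0∞} (hg : Measurable g) :
    ∫⁻ ω, g (fun t => τ t ω) * ∏ t, w t ω ∂Measure.pi (fun _ => μ) =
      ∫⁻ ω, g ω ∂Measure.pi (fun _ => μ) := by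
  have key : ∀ r ≤ n,
      ∫⁻ ω, g (transformBefore τ r ω) * weightBefore w r ω ∂Measure.pi (fun _ => μ) =
        ∫⁻ ω, g ω ∂Measure.pi (fun _ => μ) := by
    intro r
    induction r with
    | zero => intro _; simp [transformBefore_zero, weightBefore]
    | succ r ih =>
      intro hr
      rw [lintegral_transformBefore_succ μ hτ hw hτ_causal hw_causal h hg hr, ih (by omega)]
  simpa [transformBefore_self, weightBefore] using key n le_rfl

end Causal

/-! ### Gaussian shifts -/

/-- The weight is the ratio of the Gaussian density at `x + a` to that at `x`; translation
invariance of Lebesgue measure does the rest. -/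
theorem lintegral_gaussianReal_add_mul_exp {v : ℝ≥0} (hv : v ≠ 0) (a : ℝ) {g : ℝ → ℝ≥0∞}
    (hg : Measurable g) :
    ∫⁻ x, g (x + a) * ENNReal.ofReal (Real.exp (-((2 * a * x + a ^ 2) / (2 * v))))
      ∂gaussianReal 0 v = ∫⁻ x, g x ∂gaussianReal 0 v := by
  rw [gaussianReal_of_var_ne_zero _ hv,
    lintegral_withDensity_eq_lintegral_mul _ (measurable_gaussianPDF _ _) (by fun_prop),
    lintegral_withDensity_eq_lintegral_mul _ (measurable_gaussianPDF _ _) hg]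
  conv_rhs => rw [← lintegral_add_right_eq_self _ a]
  refine lintegral_congr fun x => ?_
  simp only [Pi.mul_apply, gaussianPDF]
  have : gaussianPDFReal 0 v (x + a) =
      gaussianPDFReal 0 v x * Real.exp (-((2 * a * x + a ^ 2) / (2 * v))) := by
    simp only [gaussianPDFReal, mul_assoc, ← Real.exp_add]
    congr 3
    ring
  rw [this, ENNReal.ofReal_mul (gaussianPDFReal_nonneg _ _ _)]
  ring

theorem lintegral_complexNormal (v : ℝ≥0) {g : ℂ → ℝ≥0∞} (hg : Measurable g) :
    ∫⁻ z, g z ∂complexNormal v =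
      ∫⁻ x, ∫⁻ y, g ⟨x, y⟩ ∂gaussianReal 0 (v / 2) ∂gaussianReal 0 (v / 2) := by
  rw [complexNormal, lintegral_map hg Complex.measurableEquivRealProd.symm.measurable,
    lintegral_prod]
  · rfl
  · exact (hg.comp Complex.measurableEquivRealProd.symm.measurable).aemeasurable

theorem measurable_complex_mk : Measurable fun p : ℝ × ℝ => (⟨p.1, p.2⟩ : ℂ) :=
  Complex.measurableEquivRealProd.symm.measurable

/-- The negative log-likelihood ratio of `CN(0, v)` to `CN(s, v)` at the point `z + s`. -/
noncomputable def shiftExponent (v : ℝ≥0) (s z : ℂ) : ℝ :=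
  (2 * (s.re * z.re + s.im * z.im) + ‖s‖ ^ 2) / v

theorem measurable_shiftExponent (v : ℝ≥0) :
    Measurable fun p : ℂ × ℂ => shiftExponent v p.1 p.2 := by
  unfold shiftExponent
  have := Complex.measurable_re
  have := Complex.measurable_im
  fun_prop

/-- Apply the real shift to each component. Each has variance `v / 2`, so the real denominators `2 *
(v / 2)` become `v`. -/
theorem lintegral_complexNormal_add_mul_exp {v : ℝ≥0} (hv : v ≠ 0) (s : ℂ) {g : ℂ → ℝ≥0∞}
    (hg : Measurable g) :
    ∫⁻ z, g (z + s) * ENNReal.ofReal (Real.exp (-shiftExponent v s z)) ∂complexNormal v =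
      ∫⁻ z, g z ∂complexNormal v := by
  have hv2 : v / 2 ≠ 0 := by positivity
  have hm : Measurable fun z : ℂ => shiftExponent v s z :=
    (measurable_shiftExponent v).comp measurable_prodMk_left
  rw [lintegral_complexNormal v hg, lintegral_complexNormal v (by fun_prop)]
  have hin : Measurable fun x : ℝ => ∫⁻ y, g ⟨x, y⟩ ∂gaussianReal 0 (v / 2) :=
    (hg.comp measurable_complex_mk).lintegral_prod_right'
  rw [← lintegral_gaussianReal_add_mul_exp hv2 s.re hin]
  refine lintegral_congr fun x => ?_
  have hgx : Measurable fun y : ℝ => g ⟨x + s.re, y⟩ :=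
    hg.comp (measurable_complex_mk.comp measurable_prodMk_left)
  rw [← lintegral_gaussianReal_add_mul_exp hv2 s.im hgx, ← lintegral_mul_const]
  · refine lintegral_congr fun y => ?_
    have : (⟨x, y⟩ : ℂ) + s = ⟨x + s.re, y + s.im⟩ := by
      apply Complex.ext <;> simp
    rw [this, mul_assoc, ← ENNReal.ofReal_mul (Real.exp_nonneg _), ← Real.exp_add]
    congr 3
    have hv' : (v : ℝ) ≠ 0 := by exact_mod_cast hv
    rw [shiftExponent, Complex.sq_norm, Complex.normSq_apply]
    push_cast
    field_simp
    ring
  · exact (hgx.comp (measurable_add_const s.im)).mul (by fun_prop)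

theorem measurePreserving_neg_complexNormal (v : ℝ≥0) :
    MeasurePreserving (fun z => -z) (complexNormal v) (complexNormal v) := by
  have h : MeasurePreserving (fun x : ℝ => -x) (gaussianReal 0 (v / 2)) (gaussianReal 0 (v / 2)) :=
    ⟨measurable_neg, by simp [gaussianReal_map_neg]⟩
  refine ⟨measurable_neg, ?_⟩
  rw [complexNormal, Measure.map_map measurable_neg
    Complex.measurableEquivRealProd.symm.measurable]
  conv_rhs => rw [← (h.prod h).map_eq, Measure.map_map
    Complex.measurableEquivRealProd.symm.measurable (h.prod h).measurable]
  congr 1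

theorem memLp_two_complexNormal (v : ℝ≥0) : MemLp (fun z : ℂ => z) 2 (complexNormal v) := by
  have hid : MemLp (id : ℝ → ℝ) 2 (gaussianReal 0 (v / 2)) :=
    memLp_id_gaussianReal (μ := 0) (v := v / 2) 2
  rw [complexNormal, memLp_map_measure_iff (by fun_prop)
    Complex.measurableEquivRealProd.symm.measurable.aemeasurable]
  have h1 : MemLp (fun p : ℝ × ℝ => p.1) 2
      ((gaussianReal 0 (v / 2)).prod (gaussianReal 0 (v / 2))) :=
    hid.comp_measurePreserving measurePreserving_fst
  have h2 : MemLp (fun p : ℝ × ℝ => p.2) 2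
      ((gaussianReal 0 (v / 2)).prod (gaussianReal 0 (v / 2))) :=
    hid.comp_measurePreserving measurePreserving_snd
  refine (h1.norm.add h2.norm).of_le
    Complex.measurableEquivRealProd.symm.measurable.aestronglyMeasurable
    (Filter.Eventually.of_forall fun p => ?_)
  calc ‖((fun z : ℂ => z) ∘ Complex.measurableEquivRealProd.symm) p‖
      ≤ |p.1| + |p.2| := Complex.norm_le_abs_re_add_abs_im ⟨p.1, p.2⟩
    _ ≤ _ := le_abs_self _

/-! ### Second moments and a variational inequality -/

/-- A second moment expansion for linear combinations of pairwise independent centered variables. -/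
theorem lintegral_enorm_sum_mul_sq {Ω ι : Type*} [MeasurableSpace Ω] [Fintype ι] {μ : Measure Ω}
    [IsProbabilityMeasure μ] {h : ι → Ω → ℂ} (hm : ∀ i, Measurable (h i))
    (hfin : ∀ i, ∫⁻ ω, ‖h i ω‖ₑ ^ 2 ∂μ ≠ ⊤) (hmean : ∀ i, ∫ ω, h i ω ∂μ = 0)
    (hind : ∀ i j, i ≠ j → IndepFun (h i) (h j) μ) (x : ι → ℂ) :
    ∫⁻ ω, ‖∑ i, h i ω * x i‖ₑ ^ 2 ∂μ = ∑ i, (∫⁻ ω, ‖h i ω‖ₑ ^ 2 ∂μ) * ‖x i‖ₑ ^ 2 := by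
  classical
  have hL : ∀ i, MemLp (h i) 2 μ := fun i => by
    refine ⟨(hm i).aestronglyMeasurable, ?_⟩
    rw [eLpNorm_lt_top_iff_lintegral_rpow_enorm_lt_top two_ne_zero ENNReal.ofNat_ne_top]
    simpa using (hfin i).lt_top
  have hconv : ∀ f : Ω → ℂ, MemLp f 2 μ →
      ∫⁻ ω, ‖f ω‖ₑ ^ 2 ∂μ = ENNReal.ofReal (∫ ω, ‖f ω‖ ^ 2 ∂μ) := by
    intro f hf
    rw [ofReal_integral_eq_lintegral_ofReal
      ((memLp_two_iff_integrable_sq_norm hf.1).1 hf) (by filter_upwards with ω using by positivity)]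
    refine lintegral_congr fun ω => ?_
    rw [ENNReal.ofReal_pow (norm_nonneg _), ofReal_norm]
  have hS : MemLp (fun ω => ∑ i, h i ω * x i) 2 μ :=
    memLp_finsetSum _ fun i _ => (hL i).mul_const (x i)
  have hcross : ∀ i j, Integrable (fun ω => h i ω * (starRingEnd ℂ) (h j ω)) μ := fun i j =>
    (hL i).integrable_mul (hL j).star
  have hzero : ∀ i j, i ≠ j → ∫ ω, h i ω * (starRingEnd ℂ) (h j ω) ∂μ = 0 := by
    intro i j hij
    have hi : IndepFun (h i) (fun ω => (starRingEnd ℂ) (h j ω)) μ :=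
      (hind i j hij).comp (φ := id) (ψ := starRingEnd ℂ) measurable_id (by fun_prop)
    rw [hi.integral_fun_mul_eq_mul_integral (hm i).aestronglyMeasurable
      (Complex.continuous_conj.measurable.comp (hm j)).aestronglyMeasurable, hmean i, zero_mul]
  have hdiag : ∀ i, ∫ ω, h i ω * (starRingEnd ℂ) (h i ω) ∂μ = ((∫ ω, ‖h i ω‖ ^ 2 ∂μ : ℝ) : ℂ) := by
    intro i
    rw [← integral_complex_ofReal]
    refine integral_congr_ae (Filter.Eventually.of_forall fun ω => ?_)
    simp [Complex.mul_conj, Complex.normSq_eq_norm_sq]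
  have hmain : ∫ ω, ‖∑ i, h i ω * x i‖ ^ 2 ∂μ = ∑ i, (∫ ω, ‖h i ω‖ ^ 2 ∂μ) * ‖x i‖ ^ 2 := by
    apply Complex.ofReal_injective
    rw [← integral_complex_ofReal]
    have hexp : ∀ ω, ((‖∑ i, h i ω * x i‖ ^ 2 : ℝ) : ℂ) =
        ∑ i, ∑ j, h i ω * (starRingEnd ℂ) (h j ω) * (x i * (starRingEnd ℂ) (x j)) := by
      intro ω
      rw [← Complex.normSq_eq_norm_sq, ← Complex.mul_conj, map_sum, Finset.sum_mul_sum]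
      refine Finset.sum_congr rfl fun i _ => Finset.sum_congr rfl fun j _ => ?_
      rw [map_mul]
      ring
    simp only [hexp]
    rw [integral_finsetSum _ fun i _ => integrable_finsetSum _ fun j _ =>
      (hcross i j).mul_const _]
    push_cast
    refine Finset.sum_congr rfl fun i _ => ?_
    rw [integral_finsetSum _ fun j _ => (hcross i j).mul_const _]
    simp only [integral_mul_const]
    rw [Finset.sum_eq_single i (fun j _ hji => by rw [hzero i j hji.symm, zero_mul]) (by simp),
      hdiag, Complex.mul_conj, Complex.normSq_eq_norm_sq]
    push_cast
    rfl
  rw [hconv _ hS, hmain, ENNReal.ofReal_sum_of_nonneg fun i _ => by positivity]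
  refine Finset.sum_congr rfl fun i _ => ?_
  rw [hconv _ (hL i), ENNReal.ofReal_mul (by positivity), ENNReal.ofReal_pow (norm_nonneg _),
    ofReal_norm]

/-- A variational bound: the test function `c` on `A` against the exponential tilt by `-L`. -/
theorem mul_real_le_of_lintegral_exp {Ω : Type*} [MeasurableSpace Ω] {P : Measure Ω}
    [IsProbabilityMeasure P] {A : Set Ω} (hA : MeasurableSet A) {L : Ω → ℝ} (hL : Integrable L P)
    {c b : ℝ} (hb : 0 ≤ b)
    (h : ∫⁻ ω, ENNReal.ofReal (Real.exp (A.indicator (fun _ => c) ω - L ω)) ∂P ≤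
      ENNReal.ofReal (1 + b)) :
    c * P.real A ≤ ∫ ω, L ω ∂P + b := by
  have hind : Integrable (A.indicator fun _ => c) P := (integrable_const c).indicator hA
  have hint : Integrable (fun ω => A.indicator (fun _ => c) ω - L ω) P := hind.sub hL
  have hexp : Integrable (fun ω => Real.exp (A.indicator (fun _ => c) ω - L ω)) P := by
    refine ⟨Real.continuous_exp.comp_aestronglyMeasurable hint.1, ?_⟩
    rw [hasFiniteIntegral_iff_ofReal (Filter.Eventually.of_forall fun _ => Real.exp_nonneg _)]
    exact h.trans_lt ENNReal.ofReal_lt_top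
  -- The inequality `x + 1 ≤ exp x` replaces Jensen's inequality; it yields `b` where Jensen would
  -- give `log (1 + b)`.
  have h1 : ∫ ω, (A.indicator (fun _ => c) ω - L ω + 1) ∂P ≤
      ∫ ω, Real.exp (A.indicator (fun _ => c) ω - L ω) ∂P :=
    integral_mono (hint.add (integrable_const 1)) hexp fun ω => Real.add_one_le_exp _
  have h2 : ∫ ω, Real.exp (A.indicator (fun _ => c) ω - L ω) ∂P ≤ 1 + b := by
    rw [integral_eq_lintegral_of_nonneg_ae (Filter.Eventually.of_forall fun _ => Real.exp_nonneg _)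
      hexp.1]
    exact ENNReal.toReal_le_of_le_ofReal (by positivity) h
  rw [integral_add hint (integrable_const 1), integral_sub hind hL, integral_indicator_const _ hA]
    at h1
  simp at h1
  linarith [mul_comm c (P.real A)]

/-! ### Fading moments and symmetries of the channel law -/

namespace WirelessNetwork

variable {k : ℕ} (net : WirelessNetwork k)

/-- The law of the fading state and the noise vector in one channel use. -/
noncomputable abbrev useLaw : Measure (FadingState k × (Fin k → ℂ)) :=
  net.fadingLaw.prod (Measure.pi fun _ : Fin k => complexNormal net.N₀)

instance (n : ℕ) : IsProbabilityMeasure (net.channelLaw n) := by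
  unfold channelLaw
  infer_instance

theorem measurable_link (i j : Fin k) : Measurable fun H : FadingState k => H i j := by
  fun_prop

/-- Rotation by `-1` makes the mean its own negative. Without integrability the integral is `0` by
convention, and the argument is unaffected. -/
theorem integral_link_eq_zero (i j : Fin k) : ∫ H, H i j ∂net.fadingLaw = 0 := by
  have h := net.circular i j (-1) (by simp)
  have h1 : ∫ H, -1 * H i j ∂net.fadingLaw = ∫ H, H i j ∂net.fadingLaw := by
    have e1 := integral_map (μ := net.fadingLaw) (φ := fun H => -1 * H i j) (f := fun z : ℂ => z)
      (measurable_const.mul (measurable_link i j)).aemeasurable (by fun_prop)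
    have e2 := integral_map (μ := net.fadingLaw) (φ := fun H => H i j) (f := fun z : ℂ => z)
      (measurable_link i j).aemeasurable (by fun_prop)
    rw [← e1, ← e2, h]
  simp only [neg_mul, one_mul, integral_neg] at h1
  exact self_eq_neg.1 h1.symm

theorem gain_self (i : Fin k) : net.gain i i = 0 := by
  rw [gain, lintegral_eq_zero_iff (by fun_prop)]
  filter_upwards [net.diag_zero] with H hH
  simp [hH i]

/-- The mean received power for deterministic channel inputs. -/
theorem lintegral_enorm_superposition_sq {j : Fin k} (hfin : ∀ i, net.gain i j ≠ ⊤)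
    (x : Fin k → ℂ) :
    ∫⁻ H, ‖∑ i, H i j * x i‖ₑ ^ 2 ∂net.fadingLaw = ∑ i, net.gain i j * ‖x i‖ₑ ^ 2 :=
  lintegral_enorm_sum_mul_sq (fun i => measurable_link i j) hfin
    (fun i => net.integral_link_eq_zero i j)
    (fun i l hil => net.indep i j l j fun h => hil (congrArg Prod.fst h)) x

/-- Only the noise at `j` is integrated, with the fading and the other noises frozen; a shift of
that noise may therefore depend on the current fading. -/
theorem lintegral_useLaw_congr (j : Fin k) {f g : FadingState k × (Fin k → ℂ) → ℝ≥0∞}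
    (hf : Measurable f) (hg : Measurable g)
    (h : ∀ H z, ∫⁻ u, f (H, Function.update z j u) ∂complexNormal net.N₀ =
      ∫⁻ u, g (H, Function.update z j u) ∂complexNormal net.N₀) :
    ∫⁻ x, f x ∂net.useLaw = ∫⁻ x, g x ∂net.useLaw := by
  rw [lintegral_prod _ hf.aemeasurable, lintegral_prod _ hg.aemeasurable]
  exact lintegral_congr fun H => lintegral_pi_eq_of_update _ j
    (hf.comp measurable_prodMk_left) (hg.comp measurable_prodMk_left) (h H)

/-- Reversal of the sign of all noise terms in one channel use. -/
def flipNoise {n : ℕ} (t : Fin n) (ω : Fin n → FadingState k × (Fin k → ℂ)) :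
    Fin n → FadingState k × (Fin k → ℂ) :=
  fun s => if s = t then ((ω s).1, fun i => -(ω s).2 i) else ω s

theorem measurePreserving_flipNoise {n : ℕ} (t : Fin n) :
    MeasurePreserving (flipNoise t) (net.channelLaw n) (net.channelLaw n) := by
  have h1 : MeasurePreserving (fun z : Fin k → ℂ => fun i => -z i)
      (Measure.pi fun _ : Fin k => complexNormal net.N₀)
      (Measure.pi fun _ : Fin k => complexNormal net.N₀) :=
    measurePreserving_pi _ _ fun _ => measurePreserving_neg_complexNormal _
  have h2 : ∀ s : Fin n, MeasurePreserving
      (fun x : FadingState k × (Fin k → ℂ) => if s = t then (x.1, fun i => -x.2 i) else x)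
      net.useLaw net.useLaw := by
    intro s
    split_ifs
    · exact (MeasurePreserving.id _).prod h1
    · exact MeasurePreserving.id _
  exact measurePreserving_pi _ _ h2

theorem memLp_noise {n : ℕ} (t : Fin n) (j : Fin k) :
    MemLp (fun ω => (ω t).2 j) 2 (net.channelLaw n) := by
  have h := ((measurePreserving_eval (fun _ : Fin k => complexNormal net.N₀) j).comp
    (measurePreserving_snd (μ := net.fadingLaw))).comp
    (measurePreserving_eval (fun _ : Fin n => net.useLaw) t)
  exact (memLp_two_complexNormal net.N₀).comp_measurePreserving h

end WirelessNetwork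

/-! ### Causality and received power -/

namespace NetworkCode

variable {k : ℕ} {α : Type} [MeasurableSpace α] {n M : ℕ}
  (c : NetworkCode k α n M) (net : WirelessNetwork k) (obs : FadingState k → ℂ → α)

/-- The noiseless channel output at node `j` in channel use `t`. -/
noncomputable def signal (m : Fin M) (j : Fin k) (t : Fin n)
    (ω : Fin n → FadingState k × (Fin k → ℂ)) : ℂ :=
  ∑ i, (ω t).1 i j * c.sent net obs m ω t i

theorem observed_eq (m : Fin M) (ω : Fin n → FadingState k × (Fin k → ℂ)) (t : Fin n)
    (j : Fin k) :
    c.observed net obs m ω t j = obs (ω t).1 (c.signal net obs m j t ω + (ω t).2 j) := by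
  rw [observed]
  rfl

theorem observed_congr (m : Fin M) {ω ω' : Fin n → FadingState k × (Fin k → ℂ)} (t : Fin n) :
    (∀ s ≤ t, ω s = ω' s) → ∀ j, c.observed net obs m ω t j = c.observed net obs m ω' t j := by
  induction t using WellFoundedLT.induction with
  | ind t ih =>
    intro h j
    rw [observed, observed, h t le_rfl]
    congr 2
    refine Finset.sum_congr rfl fun i _ => ?_
    split_ifs
    · rfl
    · congr 2
      funext s
      have hs : (⟨s, s.2.trans t.2⟩ : Fin n) < t := s.2
      exact ih _ hs (fun r hr => h r (hr.trans hs.le)) i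

/-- The inequality `s < t` is strict because a relay reads only earlier observations. Thus current
inputs are unaffected by the current fading and noise. -/
theorem sent_congr (m : Fin M) {ω ω' : Fin n → FadingState k × (Fin k → ℂ)} {t : Fin n}
    (h : ∀ s < t, ω s = ω' s) (i : Fin k) :
    c.sent net obs m ω t i = c.sent net obs m ω' t i := by
  unfold sent
  split_ifs
  · rfl
  · congr 1
    funext s
    have hs : (⟨s, s.2.trans t.2⟩ : Fin n) < t := s.2
    exact c.observed_congr net obs m _ (fun r hr => h r (hr.trans_lt hs)) i

theorem sent_update (m : Fin M) (ω : Fin n → FadingState k × (Fin k → ℂ)) {t s : Fin n}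
    (hts : t ≤ s) (x : FadingState k × (Fin k → ℂ)) (i : Fin k) :
    c.sent net obs m (Function.update ω s x) t i = c.sent net obs m ω t i :=
  c.sent_congr net obs m (fun _ hr => Function.update_of_ne (hr.trans_le hts).ne _ _) i

theorem signal_update_of_lt (m : Fin M) (j : Fin k) (ω : Fin n → FadingState k × (Fin k → ℂ))
    {t s : Fin n} (hts : t < s) (x : FadingState k × (Fin k → ℂ)) :
    c.signal net obs m j t (Function.update ω s x) = c.signal net obs m j t ω := by
  simp [signal, c.sent_update net obs m ω hts.le, Function.update_of_ne hts.ne]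

theorem signal_update_self (m : Fin M) (j : Fin k) (ω : Fin n → FadingState k × (Fin k → ℂ))
    (t : Fin n) (x : FadingState k × (Fin k → ℂ)) :
    c.signal net obs m j t (Function.update ω t x) =
      ∑ i, x.1 i j * c.sent net obs m ω t i := by
  simp [signal, c.sent_update net obs m ω le_rfl]

theorem signal_flipNoise (m : Fin M) (j : Fin k) (t : Fin n)
    (ω : Fin n → FadingState k × (Fin k → ℂ)) :
    c.signal net obs m j t (WirelessNetwork.flipNoise t ω) = c.signal net obs m j t ω := by
  have h : ∀ i, c.sent net obs m (WirelessNetwork.flipNoise t ω) t i = c.sent net obs m ω t i :=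
    c.sent_congr net obs m fun s hs => by simp [WirelessNetwork.flipNoise, hs.ne]
  simp [signal, h, WirelessNetwork.flipNoise]

variable {obs}

theorem measurable_observed (hobs : Measurable (Function.uncurry obs)) (m : Fin M) (t : Fin n) :
    ∀ j, Measurable fun ω => c.observed net obs m ω t j := by
  induction t using WellFoundedLT.induction with
  | ind t ih =>
    intro j
    have hx : ∀ i, Measurable fun ω : Fin n → FadingState k × (Fin k → ℂ) =>
        if i = net.src then c.codeword m t
        else c.relay i t fun s : Fin (t : ℕ) => c.observed net obs m ω ⟨s, s.2.trans t.2⟩ i := by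
      intro i
      split_ifs
      · exact measurable_const
      · exact (c.relay_measurable i t).comp
          (measurable_pi_lambda _ fun s => ih ⟨s, s.2.trans t.2⟩ s.2 i)
    have hH : ∀ i, Measurable fun ω : Fin n → FadingState k × (Fin k → ℂ) => (ω t).1 i j :=
      fun i => by fun_prop
    have hout : Measurable fun ω : Fin n → FadingState k × (Fin k → ℂ) =>
        ((ω t).1, ∑ i, (ω t).1 i j * (if i = net.src then c.codeword m t
          else c.relay i t fun s : Fin (t : ℕ) => c.observed net obs m ω ⟨s, s.2.trans t.2⟩ i)
          + (ω t).2 j) :=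
      (measurable_fst.comp (measurable_pi_apply t)).prodMk
        ((Finset.measurable_fun_sum _ fun i _ => (hH i).mul (hx i)).add (by fun_prop))
    convert hobs.comp hout using 1
    funext ω
    rw [observed]
    rfl

theorem measurable_sent (hobs : Measurable (Function.uncurry obs)) (m : Fin M) (t : Fin n)
    (i : Fin k) : Measurable fun ω => c.sent net obs m ω t i := by
  unfold sent
  split_ifs
  · exact measurable_const
  · exact (c.relay_measurable i t).comp
      (measurable_pi_lambda _ fun s => c.measurable_observed net hobs m _ i)

theorem measurable_signal (hobs : Measurable (Function.uncurry obs)) (m : Fin M) (j : Fin k)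
    (t : Fin n) : Measurable (c.signal net obs m j t) :=
  Finset.measurable_fun_sum _ fun i _ => Measurable.mul (by fun_prop)
    (c.measurable_sent net hobs m t i)

/-- The mean power of the signal received at node `j`. -/
theorem lintegral_enorm_signal_sq (hobs : Measurable (Function.uncurry obs)) (m : Fin M)
    {j : Fin k} (hfin : ∀ i, net.gain i j ≠ ⊤) (t : Fin n) :
    ∫⁻ ω, ‖c.signal net obs m j t ω‖ₑ ^ 2 ∂net.channelLaw n =
      ∑ i, net.gain i j * ∫⁻ ω, ‖c.sent net obs m ω t i‖ₑ ^ 2 ∂net.channelLaw n := by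
  have hs := c.measurable_signal net hobs m j t
  have hx := c.measurable_sent net hobs m t
  have hx' : ∀ i, Measurable fun ω => net.gain i j * ‖c.sent net obs m ω t i‖ₑ ^ 2 :=
    fun i => ((hx i).enorm.pow_const 2).const_mul _
  calc ∫⁻ ω, ‖c.signal net obs m j t ω‖ₑ ^ 2 ∂net.channelLaw n
      = ∫⁻ ω, ∑ i, net.gain i j * ‖c.sent net obs m ω t i‖ₑ ^ 2 ∂net.channelLaw n := by
        -- Average over channel use `t` alone: the inputs at `t` are then constants, so the power
        -- formula for deterministic inputs applies.
        refine lintegral_pi_eq_of_update _ t (hs.enorm.pow_const 2)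
          (Finset.measurable_fun_sum _ fun i _ => hx' i) fun ω => ?_
        simp only [signal_update_self, c.sent_update net obs m ω le_rfl]
        rw [lintegral_const, measure_univ, mul_one, ← net.lintegral_enorm_superposition_sq hfin,
          lintegral_prod _ (by fun_prop)]
        simp
    _ = _ := by
        rw [lintegral_finsetSum _ fun i _ => hx' i]
        exact Finset.sum_congr rfl fun i _ =>
          lintegral_const_mul _ ((hx i).enorm.pow_const 2)

/-! ### Likelihood ratio of the output against pure noise -/

/-- The path in which the noise at node `j` is replaced by the channel output at `j`. -/
noncomputable def receivedPath (obs : FadingState k → ℂ → α) (m : Fin M) (j : Fin k) (t : Fin n)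
    (ω : Fin n → FadingState k × (Fin k → ℂ)) : FadingState k × (Fin k → ℂ) :=
  ((ω t).1, Function.update (ω t).2 j ((ω t).2 j + c.signal net obs m j t ω))

/-- The log-likelihood ratio between the actual channel output at node `j` and pure noise. -/
noncomputable def logLikelihood (obs : FadingState k → ℂ → α) (m : Fin M) (j : Fin k)
    (ω : Fin n → FadingState k × (Fin k → ℂ)) : ℝ :=
  ∑ t, shiftExponent net.N₀ (c.signal net obs m j t ω) ((ω t).2 j)

theorem measurable_receivedPath (hobs : Measurable (Function.uncurry obs)) (m : Fin M) (j : Fin k)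
    (t : Fin n) : Measurable (c.receivedPath net obs m j t) := by
  have hs := c.measurable_signal net hobs m j t
  unfold receivedPath
  refine Measurable.prodMk (by fun_prop) (measurable_pi_lambda _ fun i => ?_)
  simp only [Function.update_apply]
  split_ifs
  · fun_prop
  · fun_prop

theorem measurable_shiftExponent_signal (hobs : Measurable (Function.uncurry obs)) (m : Fin M)
    (j : Fin k) (t : Fin n) :
    Measurable fun ω => shiftExponent net.N₀ (c.signal net obs m j t ω) ((ω t).2 j) :=
  (measurable_shiftExponent net.N₀).comp
    ((c.measurable_signal net hobs m j t).prodMk (by fun_prop))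

/-- At each time the shift is determined by the past and the current fading, so the complex Gaussian
shift supplies the one-use identity required by `lintegral_causal_transform`. -/
theorem lintegral_receivedPath_mul_exp (hobs : Measurable (Function.uncurry obs)) (m : Fin M)
    (j : Fin k) {g : (Fin n → FadingState k × (Fin k → ℂ)) → ℝ≥0∞} (hg : Measurable g) :
    ∫⁻ ω, g (fun t => c.receivedPath net obs m j t ω) *
        ENNReal.ofReal (Real.exp (-c.logLikelihood net obs m j ω)) ∂net.channelLaw n =
      ∫⁻ ω, g ω ∂net.channelLaw n := by
  have hprod : ∀ ω, ENNReal.ofReal (Real.exp (-c.logLikelihood net obs m j ω)) =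
      ∏ t, ENNReal.ofReal
        (Real.exp (-shiftExponent net.N₀ (c.signal net obs m j t ω) ((ω t).2 j))) := by
    intro ω
    rw [logLikelihood, ← Finset.sum_neg_distrib, Real.exp_sum,
      ENNReal.ofReal_prod_of_nonneg fun _ _ => Real.exp_nonneg _]
  have hw : ∀ t, Measurable fun ω : Fin n → FadingState k × (Fin k → ℂ) => ENNReal.ofReal
      (Real.exp (-shiftExponent net.N₀ (c.signal net obs m j t ω) ((ω t).2 j))) := fun t => by
    have := c.measurable_shiftExponent_signal net hobs m j t
    fun_prop
  simp only [hprod]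
  refine lintegral_causal_transform net.useLaw (c.measurable_receivedPath net hobs m j) hw
    (fun t s hts ω x => ?_) (fun t s hts ω x => ?_) (fun t ω g hg => ?_) hg
  · simp [receivedPath, c.signal_update_of_lt net obs m j ω hts, Function.update_of_ne hts.ne]
  · simp [c.signal_update_of_lt net obs m j ω hts, Function.update_of_ne hts.ne]
  · refine net.lintegral_useLaw_congr j ?_ hg fun H z => ?_
    · exact (hg.comp ((c.measurable_receivedPath net hobs m j t).comp (measurable_update ω))).mul
        ((hw t).comp (measurable_update ω))
    · simp only [receivedPath, signal_update_self, Function.update_self, Function.update_idem]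
      exact lintegral_complexNormal_add_mul_exp net.N₀_pos.ne' _
        (hg.comp (measurable_prodMk_left.comp (measurable_update z)))

theorem memLp_signal (hobs : Measurable (Function.uncurry obs)) (m : Fin M) (j : Fin k) (t : Fin n)
    (h : ∫⁻ ω, ‖c.signal net obs m j t ω‖ₑ ^ 2 ∂net.channelLaw n ≠ ⊤) :
    MemLp (c.signal net obs m j t) 2 (net.channelLaw n) := by
  refine ⟨(c.measurable_signal net hobs m j t).aestronglyMeasurable, ?_⟩
  rw [eLpNorm_lt_top_iff_lintegral_rpow_enorm_lt_top two_ne_zero ENNReal.ofNat_ne_top]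
  simpa using h.lt_top

/-- The signal is uncorrelated with the current noise. -/
theorem integral_shiftExponent_signal (hobs : Measurable (Function.uncurry obs)) (m : Fin M)
    (j : Fin k) (t : Fin n)
    (h : ∫⁻ ω, ‖c.signal net obs m j t ω‖ₑ ^ 2 ∂net.channelLaw n ≠ ⊤) :
    Integrable (fun ω => shiftExponent net.N₀ (c.signal net obs m j t ω) ((ω t).2 j))
        (net.channelLaw n) ∧
      ∫ ω, shiftExponent net.N₀ (c.signal net obs m j t ω) ((ω t).2 j) ∂net.channelLaw n =
        (∫⁻ ω, ‖c.signal net obs m j t ω‖ₑ ^ 2 ∂net.channelLaw n).toReal / net.N₀ := by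
  have hS := c.memLp_signal net hobs m j t h
  have hZ := net.memLp_noise t j
  have hre : Integrable (fun ω => (c.signal net obs m j t ω).re * ((ω t).2 j).re)
      (net.channelLaw n) := hS.re.integrable_mul hZ.re
  have him : Integrable (fun ω => (c.signal net obs m j t ω).im * ((ω t).2 j).im)
      (net.channelLaw n) := hS.im.integrable_mul hZ.im
  have hcross : Integrable (fun ω => 2 * ((c.signal net obs m j t ω).re * ((ω t).2 j).re +
      (c.signal net obs m j t ω).im * ((ω t).2 j).im)) (net.channelLaw n) :=
    (hre.add him).const_mul 2
  have hsq := (memLp_two_iff_integrable_sq_norm hS.1).1 hS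
  refine ⟨(hcross.add hsq).div_const _, ?_⟩
  have hzero : ∫ ω, 2 * ((c.signal net obs m j t ω).re * ((ω t).2 j).re +
      (c.signal net obs m j t ω).im * ((ω t).2 j).im) ∂net.channelLaw n = 0 := by
    -- Flipping the noise at time `t` preserves the law and the signal at `t` but negates the cross
    -- term, whose mean must then vanish.
    have hflip := net.measurePreserving_flipNoise t
    have h1 := integral_map hflip.measurable.aemeasurable (hflip.map_eq.symm ▸ hcross.1)
    rw [hflip.map_eq] at h1
    simp only [signal_flipNoise] at h1
    simp only [WirelessNetwork.flipNoise, if_true, Complex.neg_re, Complex.neg_im, mul_neg,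
      ← neg_add] at h1
    rw [integral_neg] at h1
    exact self_eq_neg.1 h1
  simp only [shiftExponent]
  rw [integral_div, integral_add hcross hsq, hzero, zero_add,
    integral_eq_lintegral_of_nonneg_ae (Filter.Eventually.of_forall fun _ => sq_nonneg _) hsq.1]
  congr 3
  funext ω
  rw [ENNReal.ofReal_pow (norm_nonneg _), ofReal_norm]

/-- The event that node `j` decodes message `m` when its channel output is pure noise. -/
def noiseDecodes (obs : FadingState k → ℂ → α) (j : Fin k) (m : Fin M) :
    Set (Fin n → FadingState k × (Fin k → ℂ)) :=
  {ω | c.decode j (fun t => obs (ω t).1 ((ω t).2 j)) = m}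

theorem measurableSet_noiseDecodes (hobs : Measurable (Function.uncurry obs)) (j : Fin k)
    (m : Fin M) : MeasurableSet (c.noiseDecodes obs j m) := by
  have h : Measurable fun ω : Fin n → FadingState k × (Fin k → ℂ) =>
      fun t => obs (ω t).1 ((ω t).2 j) :=
    measurable_pi_lambda _ fun t => hobs.comp
      (f := fun ω : Fin n → FadingState k × (Fin k → ℂ) => ((ω t).1, (ω t).2 j)) (by fun_prop)
  exact (c.decode_measurable j).comp h (measurableSet_singleton m)

/-- Pure noise carries no message, so these events partition the space. This total of `1` offsets
the factor `M` once messages are averaged. -/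
theorem sum_noiseDecodes (hobs : Measurable (Function.uncurry obs)) (j : Fin k) :
    ∑ m, (net.channelLaw n).real (c.noiseDecodes obs j m) = 1 := by
  rw [← measureReal_biUnion_finset (fun m _ m' _ hm => ?_)
    (fun m _ => c.measurableSet_noiseDecodes hobs j m)]
  · have : ⋃ m ∈ Finset.univ, c.noiseDecodes obs j m = Set.univ := by
      ext ω
      simp [noiseDecodes]
    rw [this, probReal_univ]
  · exact Set.disjoint_left.2 fun ω h h' => hm (h.symm.trans h')

theorem observed_eq_receivedPath (m : Fin M) (ω : Fin n → FadingState k × (Fin k → ℂ))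
    (t : Fin n) (j : Fin k) :
    c.observed net obs m ω t j =
      obs (c.receivedPath net obs m j t ω).1 ((c.receivedPath net obs m j t ω).2 j) := by
  simp [observed_eq, receivedPath, add_comm]

/-- Correct decoding at node `j` costs received energy. -/
theorem log_mul_prob_correct_le (hobs : Measurable (Function.uncurry obs)) (m : Fin M) {j : Fin k}
    (hsig : ∀ t, ∫⁻ ω, ‖c.signal net obs m j t ω‖ₑ ^ 2 ∂net.channelLaw n ≠ ⊤) :
    Real.log M * (net.channelLaw n).real
        {ω | c.decode j (fun t => c.observed net obs m ω t j) = m} ≤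
      (∑ t, ∫⁻ ω, ‖c.signal net obs m j t ω‖ₑ ^ 2 ∂net.channelLaw n).toReal / net.N₀ +
        M * (net.channelLaw n).real (c.noiseDecodes obs j m) := by
  have hM : 0 < (M : ℝ) := Nat.cast_pos.2 m.pos
  set A := {ω | c.decode j (fun t => c.observed net obs m ω t j) = m} with hAdef
  set B := c.noiseDecodes obs j m with hBdef
  have hA : MeasurableSet A :=
    ((c.decode_measurable j).comp
      (measurable_pi_lambda _ fun t => c.measurable_observed net hobs m t j))
      (measurableSet_singleton m)
  have hB : MeasurableSet B := c.measurableSet_noiseDecodes hobs j m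
  have hAB : ∀ ω, ω ∈ A ↔ (fun t => c.receivedPath net obs m j t ω) ∈ B := by
    intro ω
    simp only [hAdef, hBdef, noiseDecodes, Set.mem_ofPred_eq, observed_eq_receivedPath]
  have hterm := fun t => c.integral_shiftExponent_signal net hobs m j t (hsig t)
  have hL : Integrable (c.logLikelihood net obs m j) (net.channelLaw n) :=
    integrable_finsetSum _ fun t _ => (hterm t).1
  have hLint : ∫ ω, c.logLikelihood net obs m j ω ∂net.channelLaw n =
      (∑ t, ∫⁻ ω, ‖c.signal net obs m j t ω‖ₑ ^ 2 ∂net.channelLaw n).toReal / net.N₀ := by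
    simp only [logLikelihood]
    rw [integral_finsetSum _ fun t _ => (hterm t).1, ENNReal.toReal_sum fun t _ => hsig t,
      Finset.sum_div]
    exact Finset.sum_congr rfl fun t _ => (hterm t).2
  rw [← hLint]
  -- The test height is `log M`, whose exponential is `M`, and `b` is `M` times the pure-noise
  -- probability of `B`.
  refine mul_real_le_of_lintegral_exp hA hL (by positivity) ?_
  have hg : Measurable fun ω => 1 + B.indicator (fun _ => (M : ℝ≥0∞)) ω :=
    (measurable_const.indicator hB).const_add 1
  calc ∫⁻ ω, ENNReal.ofReal (Real.exp (A.indicator (fun _ => Real.log M) ω -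
        c.logLikelihood net obs m j ω)) ∂net.channelLaw n
      ≤ ∫⁻ ω, (1 + B.indicator (fun _ => (M : ℝ≥0∞)) (fun t => c.receivedPath net obs m j t ω)) *
        ENNReal.ofReal (Real.exp (-c.logLikelihood net obs m j ω)) ∂net.channelLaw n := by
        refine lintegral_mono fun ω => ?_
        rw [sub_eq_add_neg, Real.exp_add, ENNReal.ofReal_mul (Real.exp_nonneg _)]
        gcongr
        -- Without the common weight, the comparison is `M ≤ 1 + M` on `A` and `1 ≤ 1` off it.
        by_cases hω : ω ∈ A
        · rw [Set.indicator_of_mem hω, Set.indicator_of_mem ((hAB ω).1 hω), Real.exp_log hM]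
          simp
        · rw [Set.indicator_of_notMem hω]
          simp
    _ = ENNReal.ofReal (1 + M * (net.channelLaw n).real B) := by
        rw [c.lintegral_receivedPath_mul_exp net hobs m j hg,
          lintegral_add_left measurable_const, lintegral_indicator_const hB,
          ENNReal.ofReal_add zero_le_one (by positivity), ENNReal.ofReal_mul hM.le]
        simp
    _ ≤ _ := le_rfl

end NetworkCode

/-! ### Energy budget and converse for a single code -/

namespace WirelessNetwork

variable {k : ℕ} (net : WirelessNetwork k)

/-- Self-gains vanish, so erasing `i` from `R` loses nothing. -/
theorem sum_gain_le (R : Finset (Fin k)) (hR : R.Nonempty) (i : Fin k) :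
    ∑ j ∈ R, net.gain i j ≤ net.effectiveRadius R * R.card := by
  rw [effectiveRadius, ENNReal.div_mul_cancel (by simp [hR.ne_empty]) (by simp)]
  refine le_trans (le_of_eq ?_) (le_iSup (fun i => ∑ j ∈ R.erase i, net.gain i j) i)
  by_cases hi : i ∈ R
  · rw [← Finset.add_sum_erase R _ hi, net.gain_self, zero_add]
  · rw [Finset.erase_eq_of_notMem hi]

theorem gain_ne_top {R : Finset (Fin k)} (hG : net.effectiveRadius R ≠ ⊤) {j : Fin k} (hj : j ∈ R)
    (i : Fin k) : net.gain i j ≠ ⊤ := by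
  refine ne_top_of_le_ne_top (ENNReal.mul_ne_top hG (ENNReal.natCast_ne_top R.card))
    (le_trans ?_ (net.sum_gain_le R ⟨j, hj⟩ i))
  exact Finset.single_le_sum (f := fun j => net.gain i j) (fun _ _ => zero_le) hj

end WirelessNetwork

namespace NetworkCode

variable {k : ℕ} {α : Type} [MeasurableSpace α] {n M : ℕ}
  (c : NetworkCode k α n M) (net : WirelessNetwork k) {obs : FadingState k → ℂ → α}

theorem energy_mul_eq (hobs : Measurable (Function.uncurry obs)) (hM : M ≠ 0) :
    c.energy net obs * M =
      ∑ m, ∑ i, ∑ t, ∫⁻ ω, ‖c.sent net obs m ω t i‖ₑ ^ 2 ∂net.channelLaw n := by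
  have hx : ∀ m i t, Measurable fun ω => ‖c.sent net obs m ω t i‖ₑ ^ 2 :=
    fun m i t => (c.measurable_sent net hobs m t i).enorm.pow_const 2
  rw [energy, ENNReal.div_mul_cancel (by simpa using hM) (by simp)]
  refine Finset.sum_congr rfl fun m _ => ?_
  rw [lintegral_finsetSum _ fun i _ => Finset.measurable_fun_sum _ fun t _ => hx m i t]
  exact Finset.sum_congr rfl fun i _ => lintegral_finsetSum _ fun t _ => hx m i t

/-- The total received energy is at most the transmitted energy times `|R|` times the effective
network radius. -/
theorem sum_received_energy_le (hobs : Measurable (Function.uncurry obs)) (hM : M ≠ 0)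
    {R : Finset (Fin k)} (hR : R.Nonempty) (hG : net.effectiveRadius R ≠ ⊤) :
    ∑ j ∈ R, ∑ m, ∑ t, ∫⁻ ω, ‖c.signal net obs m j t ω‖ₑ ^ 2 ∂net.channelLaw n ≤
      net.effectiveRadius R * R.card * (c.energy net obs * M) := by
  rw [c.energy_mul_eq net hobs hM]
  set e : Fin M → Fin k → Fin n → ℝ≥0∞ := fun m i t =>
    ∫⁻ ω, ‖c.sent net obs m ω t i‖ₑ ^ 2 ∂net.channelLaw n with he
  calc ∑ j ∈ R, ∑ m, ∑ t, ∫⁻ ω, ‖c.signal net obs m j t ω‖ₑ ^ 2 ∂net.channelLaw n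
      = ∑ j ∈ R, ∑ m, ∑ t, ∑ i, net.gain i j * e m i t :=
        Finset.sum_congr rfl fun j hj => Finset.sum_congr rfl fun m _ =>
          Finset.sum_congr rfl fun t _ =>
            c.lintegral_enorm_signal_sq net hobs m (net.gain_ne_top hG hj) t
    _ = ∑ m, ∑ i, ∑ t, (∑ j ∈ R, net.gain i j) * e m i t := by
        rw [Finset.sum_comm]
        refine Finset.sum_congr rfl fun m _ => ?_
        rw [Finset.sum_comm, Finset.sum_comm (s := (Finset.univ : Finset (Fin k)))]
        refine Finset.sum_congr rfl fun t _ => ?_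
        rw [Finset.sum_comm]
        exact Finset.sum_congr rfl fun i _ => by rw [Finset.sum_mul]
    _ ≤ ∑ m, ∑ i, ∑ t, net.effectiveRadius R * R.card * e m i t := by
        gcongr with m _ i _ t _
        exact net.sum_gain_le R hR i
    _ = net.effectiveRadius R * R.card * ∑ m, ∑ i, ∑ t, e m i t := by
        simp only [Finset.mul_sum]

theorem le_sum_prob_correct (hM : M ≠ 0) {R : Finset (Fin k)} {ε : ℝ} (hε : 0 ≤ ε)
    (herr : c.errorProb net obs R ≤ ENNReal.ofReal ε) {j : Fin k} (hj : j ∈ R) :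
    M * (1 - ε) ≤ ∑ m, (net.channelLaw n).real
      {ω | c.decode j (fun t => c.observed net obs m ω t j) = m} := by
  set err : Fin M → Set (Fin n → FadingState k × (Fin k → ℂ)) := fun m =>
    {ω | ∃ j ∈ R, c.decode j (fun t => c.observed net obs m ω t j) ≠ m} with herrdef
  have h1 : ∑ m, (net.channelLaw n).real (err m) ≤ M * ε := by
    have h : ∑ m, net.channelLaw n (err m) ≤ ENNReal.ofReal (ε * M) := by
      rw [errorProb, ENNReal.div_le_iff (by simpa using hM) (by simp)] at herr
      rw [ENNReal.ofReal_mul hε]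
      simpa using herr
    have := ENNReal.toReal_le_of_le_ofReal (by positivity) h
    rw [ENNReal.toReal_sum fun m _ => measure_ne_top _ _] at this
    rw [mul_comm]
    exact this
  have h2 : ∀ m, 1 - (net.channelLaw n).real (err m) ≤ (net.channelLaw n).real
      {ω | c.decode j (fun t => c.observed net obs m ω t j) = m} := by
    intro m
    have hu : Set.univ = err m ∪ {ω | c.decode j (fun t => c.observed net obs m ω t j) = m} := by
      refine (Set.eq_univ_of_forall fun ω => ?_).symm
      by_cases h : c.decode j (fun t => c.observed net obs m ω t j) = m
      · exact Or.inr h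
      · exact Or.inl ⟨j, hj, h⟩
    -- Subadditivity needs no measurability of the two events.
    have := measureReal_union_le (μ := net.channelLaw n) (err m)
      {ω | c.decode j (fun t => c.observed net obs m ω t j) = m}
    rw [← hu, probReal_univ] at this
    linarith
  have h3 := Finset.sum_le_sum fun m (_ : m ∈ Finset.univ) => h2 m
  simp only [Finset.sum_sub_distrib, Finset.sum_const, Finset.card_univ, Fintype.card_fin,
    nsmul_eq_mul, mul_one] at h3
  linarith

/-- The converse bound on the number of messages of a code with given energy and reliability. -/
theorem log_card_le (hobs : Measurable (Function.uncurry obs)) (hM : M ≠ 0)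
    {R : Finset (Fin k)} (hR : R.Nonempty) (hG : net.effectiveRadius R ≠ ⊤) {E ε : ℝ} (hE : 0 ≤ E)
    (hε : 0 ≤ ε) (henergy : c.energy net obs ≤ ENNReal.ofReal E)
    (herr : c.errorProb net obs R ≤ ENNReal.ofReal ε) :
    (1 - ε) * Real.log M ≤ (net.effectiveRadius R).toReal * E / net.N₀ + 1 := by
  set U : Fin k → Fin M → ℝ≥0∞ := fun j m =>
    ∑ t, ∫⁻ ω, ‖c.signal net obs m j t ω‖ₑ ^ 2 ∂net.channelLaw n with hU
  set G := (net.effectiveRadius R).toReal with hGdef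
  have hM' : 0 < (M : ℝ) := by positivity
  have hcard : 0 < (R.card : ℝ) := Nat.cast_pos.2 hR.card_pos
  have hN : 0 < (net.N₀ : ℝ) := net.N₀_pos
  have hlog : 0 ≤ Real.log M := Real.log_natCast_nonneg M
  have htot : ∑ j ∈ R, ∑ m, U j m ≤ ENNReal.ofReal (G * R.card * (E * M)) := by
    refine (c.sum_received_energy_le net hobs hM hR hG).trans ?_
    rw [ENNReal.ofReal_mul (by positivity), ENNReal.ofReal_mul (by positivity),
      ENNReal.ofReal_mul hE, hGdef, ENNReal.ofReal_toReal hG, ENNReal.ofReal_natCast,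
      ENNReal.ofReal_natCast]
    gcongr
  have hfin : ∀ j ∈ R, ∀ m, U j m ≠ ⊤ := fun j hj m => by
    have h1 := ENNReal.sum_ne_top.1 (ne_top_of_le_ne_top ENNReal.ofReal_ne_top htot) j hj
    exact ENNReal.sum_ne_top.1 h1 m (Finset.mem_univ m)
  have htot' : ∑ j ∈ R, ∑ m, (U j m).toReal ≤ G * R.card * (E * M) := by
    have h := ENNReal.toReal_le_of_le_ofReal (by positivity) htot
    rw [ENNReal.toReal_sum fun j hj => ENNReal.sum_ne_top.2 fun m _ => hfin j hj m] at h
    refine le_trans (le_of_eq (Finset.sum_congr rfl fun j hj => ?_)) h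
    rw [ENNReal.toReal_sum fun m _ => hfin j hj m]
  -- Sum over messages at one destination: the pure-noise terms contribute exactly `M`.
  have hj : ∀ j ∈ R, Real.log M * (M * (1 - ε)) - M ≤ (∑ m, (U j m).toReal) / net.N₀ := by
    intro j hj
    have h1 := Finset.sum_le_sum fun m (_ : m ∈ Finset.univ) =>
      c.log_mul_prob_correct_le net hobs m
        fun t => ENNReal.sum_ne_top.1 (hfin j hj m) t (Finset.mem_univ t)
    rw [← Finset.mul_sum, Finset.sum_add_distrib, ← Finset.mul_sum, ← Finset.sum_div,
      c.sum_noiseDecodes net hobs j, mul_one] at h1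
    have h2 := mul_le_mul_of_nonneg_left (c.le_sum_prob_correct net hM hε herr hj) hlog
    linarith
  have hsum := Finset.sum_le_sum hj
  rw [Finset.sum_const, nsmul_eq_mul, ← Finset.sum_div] at hsum
  have h := hsum.trans (div_le_div_of_nonneg_right htot' hN.le)
  have h' : (R.card * M : ℝ) * ((1 - ε) * Real.log M) ≤
      (R.card * M : ℝ) * (G * E / net.N₀ + 1) := by
    have e : G * R.card * (E * M) / net.N₀ = R.card * M * (G * E / net.N₀) := by ring
    rw [e] at h
    linarith
  exact le_of_mul_le_mul_left h' (by positivity)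

end NetworkCode

/-! ### Limit of large energy -/

namespace WirelessNetwork

variable {k : ℕ} {α : Type} [MeasurableSpace α] (net : WirelessNetwork k)
  {obs : FadingState k → ℂ → α}

theorem mul_log_two_le_of_isEpsAchievable (hobs : Measurable (Function.uncurry obs))
    {R : Finset (Fin k)} (hR : R.Nonempty) (hG : net.effectiveRadius R ≠ ⊤) {ε : ℝ} (hε : 0 < ε)
    {Eb : ℝ≥0} (h : net.IsEpsAchievable obs R ε Eb) {δ : ℝ} (hδ : 0 < δ) :
    (1 - ε) * Real.log 2 ≤ (net.effectiveRadius R).toReal * (Eb + δ) / net.N₀ + δ := by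
  obtain ⟨E₀, hE₀, hE⟩ := h δ hδ
  have hb : 0 < (Eb : ℝ) + δ := by positivity
  -- With this energy, `log₂ M > E / (Eb + δ) ≥ 1 / δ`, so the additive `1` of the converse is at
  -- most `δ * log₂ M`.
  set E := max E₀ ((Eb + δ) / δ) with hEdef
  have hE0 : 0 ≤ E := hE₀.trans (le_max_left _ _)
  obtain ⟨n, M, hM, ⟨c, hc, herr⟩, hlt⟩ := hE E (le_max_left _ _)
  have hM1 : (1 : ℝ) < M := by exact_mod_cast hM
  have hB : 0 < Real.logb 2 M := Real.logb_pos one_lt_two hM1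
  have hlog : Real.log M = Real.logb 2 M * Real.log 2 := by
    rw [Real.logb, div_mul_cancel₀ _ (Real.log_pos one_lt_two).ne']
  have hkey := c.log_card_le net hobs (by omega) hR hG hE0 hε.le hc herr
  rw [div_lt_iff₀ hB] at hlt
  have hB1 : 1 ≤ δ * Real.logb 2 M := by
    have h1 : (Eb + δ) / δ < (Eb + δ) * Real.logb 2 M := (le_max_right _ _).trans_lt hlt
    rw [div_lt_iff₀ hδ, mul_assoc] at h1
    have := (lt_mul_iff_one_lt_right hb).1 h1
    linarith
  set G := (net.effectiveRadius R).toReal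
  have hG0 : 0 ≤ G := ENNReal.toReal_nonneg
  have hN : 0 < (net.N₀ : ℝ) := net.N₀_pos
  have h2 : G * E / net.N₀ ≤ G * ((Eb + δ) * Real.logb 2 M) / net.N₀ := by gcongr
  have h3 : Real.logb 2 M * ((1 - ε) * Real.log 2) ≤
      Real.logb 2 M * (G * (Eb + δ) / net.N₀ + δ) := by
    rw [hlog] at hkey
    have e : G * ((Eb + δ) * Real.logb 2 M) / net.N₀ =
      Real.logb 2 M * (G * (Eb + δ) / net.N₀) := by ring
    rw [e] at h2
    linarith
  exact le_of_mul_le_mul_left h3 hB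

theorem log_two_le_of_isAchievable (hobs : Measurable (Function.uncurry obs))
    {R : Finset (Fin k)} (hR : R.Nonempty) (hG : net.effectiveRadius R ≠ ⊤)
    {Eb : ℝ≥0} (h : net.IsAchievable obs R Eb) :
    Real.log 2 ≤ (net.effectiveRadius R).toReal * Eb / net.N₀ := by
  set G := (net.effectiveRadius R).toReal
  have hbound : ∀ᶠ δ : ℝ in nhdsWithin 0 (Set.Ioi 0),
      (1 - δ) * Real.log 2 ≤ G * (Eb + δ) / net.N₀ + δ := by
    filter_upwards [Ioo_mem_nhdsGT (zero_lt_one (α := ℝ))] with δ hδ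
    -- The error probability and the energy slack are taken equal, so that one limit `δ → 0` removes
    -- both.
    exact net.mul_log_two_le_of_isEpsAchievable hobs hR hG hδ.1 (h δ hδ.1 hδ.2) hδ.1
  have hl : Filter.Tendsto (fun δ : ℝ => (1 - δ) * Real.log 2) (nhdsWithin 0 (Set.Ioi 0))
      (nhds ((1 - 0) * Real.log 2)) :=
    (Continuous.tendsto (by fun_prop) 0).mono_left nhdsWithin_le_nhds
  have hr : Filter.Tendsto (fun δ : ℝ => G * (Eb + δ) / net.N₀ + δ) (nhdsWithin 0 (Set.Ioi 0))
      (nhds (G * (Eb + 0) / net.N₀ + 0)) :=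
    (Continuous.tendsto (by fun_prop) 0).mono_left nhdsWithin_le_nhds
  simpa using le_of_tendsto_of_tendsto hl hr hbound

/-- The converse for any measurable observation model. -/
theorem le_normalizedMinEnergyPerBit (hobs : Measurable (Function.uncurry obs))
    {R : Finset (Fin k)} (hR : R.Nonempty) :
    ENNReal.ofReal (Real.log 2) / net.effectiveRadius R ≤
      net.normalizedMinEnergyPerBit obs R := by
  by_cases hG : net.effectiveRadius R = ⊤
  · simp [hG]
  have hN : (net.N₀ : ℝ≥0∞) ≠ 0 := by exact_mod_cast net.N₀_pos.ne'
  rw [normalizedMinEnergyPerBit, ENNReal.le_div_iff_mul_le (Or.inl hN) (Or.inl ENNReal.coe_ne_top)]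
  refine le_iInf₂ fun Eb hEb => ?_
  rw [← ENNReal.le_div_iff_mul_le (Or.inl hN) (Or.inl ENNReal.coe_ne_top)]
  -- Radius `0` needs no separate case: the next inequality would then read `log 2 ≤ 0`, so no `Eb`
  -- is achievable.
  refine ENNReal.div_le_of_le_mul ?_
  refine (ENNReal.ofReal_le_ofReal (net.log_two_le_of_isAchievable hobs hR hG hEb)).trans
    (le_of_eq ?_)
  rw [ENNReal.ofReal_div_of_pos (by exact_mod_cast net.N₀_pos),
    ENNReal.ofReal_mul ENNReal.toReal_nonneg, ENNReal.ofReal_toReal hG,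
    ENNReal.ofReal_coe_nnreal, ENNReal.ofReal_coe_nnreal, ENNReal.mul_div_right_comm, mul_comm,
    div_eq_mul_inv, div_eq_mul_inv]
  ring

end WirelessNetwork

theorem theorem1 {k : ℕ} (net : WirelessNetwork k) (R : Finset (Fin k))
    (hR : R.Nonempty) (hsrc : net.src ∉ R) :
    ENNReal.ofReal (Real.log 2) / net.effectiveRadius R
        ≤ net.normalizedMinEnergyPerBit (outputOnly k) R ∧
      ENNReal.ofReal (Real.log 2) / net.effectiveRadius R
        ≤ net.normalizedMinEnergyPerBit (outputAndFading k) R :=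
  ⟨net.le_normalizedMinEnergyPerBit measurable_snd hR,
    net.le_normalizedMinEnergyPerBit (measurable_snd.prodMk measurable_fst) hR⟩
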